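/- Let $K$ be a commutative field, $\theta\colon K\to K$ a ring homomorphism and $\delta\colon K\to K$ a $\theta$-derivation, i.e. an additive map with $\delta(ab)=\theta(a)\delta(b)+\delta(a)b$ for all $a,b\in K$. Put $F=\{a\in K:\theta(a)=a,\ \delta(a)=0\}$, a subfield of $K$, and assume that $[K:F]<\infty$ and $(\theta,\delta)\neq(\mathrm{id}_K,0)$. Let $K[X;\theta,\delta]$ be the ring of Ore polynomials, i.e. of polynomials $\sum_i a_iX^i$ over $K$ with the usual addition and with the multiplication determined by $Xa=\theta(a)X+\delta(a)$ for $a\in K$. There is a monic $Z\in K[X;\theta,\delta]$ such that the centre of $K[X;\theta,\delta]$ is $F[Z]$; it can moreover be chosen normalized, i.e. a linearized polynomial (only exponents $p^j$ occur, where $p>0$ is the characteristic of $K$) if $\theta=\mathrm{id}_K$, and a power of an Ore polynomial of degree $1$ otherwise. Fix any monic $Z$ (normalized or not) such that the centre is $F[Z]$. For $c\in K$, let $\upsilon(c)\in K$ be the remainder of the right Euclidean division of $Z$ by $X-c$, i.e. the unique $r\in K$ with $Z=Q\,(X-c)+r$ for some $Q\in K[X;\theta,\delta]$. Call $c$ ramified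 if $\delta+c\theta$ is a $K$-scalar multiple of $\mathrm{id}_K$, and unramified otherwise. For $P=\sum_i a_iX^i$, put $\mathrm{ev}_c(P)=\sum_i a_i(\delta+c\theta)^i\in\mathrm{End}_F(K)$. Let $\underline c=(c_1,\dots,c_m)$ be a tuple of unramified elements of $K$, let $\underline V=(V_1,\dots,V_m)$ be a tuple of $F$-linear subspaces of $K$, and let $n=\sum_{i=1}^m\dim_F V_i$. A code is a $K$-linear subspace $C$ of $\mathrm{Hom}_F(\underline V,K)=\prod_{i=1}^m\mathrm{Hom}_F(V_i,K)$; its length is $\sum_{i=1}^m\dim_F V_i$, its dimension is $\dim_K C$ and, if $C\ne0$, its minimum sum-rank distance is the least sum-rank weight $\sum_{i=1}^m\dim_F\varphi_i(V_i)$ of a nonzero element $(\varphi_1,\dots,\varphi_m)$ of $C$. A nonzero code of length $n$, dimension $k$ and minimum sum-rank distance $d$ is called MSRD if $k+d=n+1$, i.e. if it attains the Singleton bound $k+d\le n+1$. For an integer $k\ge0$, the linearized Reed-Solomon code is $$\mathrm{LRS}(k,\underline c,\underline V)=\big\{\big(\mathrm{ev}_{c_1}(P)_{|V_1},\dots,\mathrm{ev}_{c_m}(P)_{|V_m}\big)\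 :\ P\in K[X;\theta,\delta],\ \deg P<k\big\}.$$ Theorem. If $0\le k\le n$ and $\upsilon(c_1),\dots,\upsilon(c_m)$ are pairwise distinct, then $\mathrm{LRS}(k,\underline c,\underline V)$ has length $n$ and dimension $k$. If moreover $k\ge1$, its minimum sum-rank distance is $n-k+1$; in particular, it is MSRD. -/

import Mathlib

noncomputable section

/-- A `θ`-derivation of `K`: an additive map with `δ (a b) = θ a * δ b + δ a * b`. -/
structure TwistedDerivation {K : Type*} [Field K] (θ : K →+* K) where
  toAddMonoidHom : K →+ K
  leibniz : ∀ a b : K,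
    toAddMonoidHom (a * b) = θ a * toAddMonoidHom b + toAddMonoidHom a * b

instance {K : Type*} [Field K] (θ : K →+* K) :
    CoeFun (TwistedDerivation θ) (fun _ => K → K) :=
  ⟨fun δ => δ.toAddMonoidHom⟩

theorem TwistedDerivation.map_one {K : Type*} [Field K] {θ : K →+* K}
    (δ : TwistedDerivation θ) : δ 1 = 0 := by
  have h := δ.leibniz 1 1
  simpa using h

/-- The subfield `F` of the elements `a` of `K` with `θ a = a` and `δ a = 0`. -/
def constantField {K : Type*} [Field K] (θ : K →+* K) (δ : TwistedDerivation θ) :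
    Subfield K where
  carrier := {a | θ a = a ∧ δ a = 0}
  mul_mem' := by
    rintro a b ⟨ha, ha'⟩ ⟨hb, hb'⟩
    exact ⟨by simp [ha, hb], by rw [δ.leibniz, ha', hb']; simp⟩
  one_mem' := ⟨map_one θ, δ.map_one⟩
  add_mem' := by
    rintro a b ⟨ha, ha'⟩ ⟨hb, hb'⟩
    exact ⟨by simp [ha, hb], by simp [ha', hb']⟩
  zero_mem' := ⟨map_zero θ, map_zero δ.toAddMonoidHom⟩
  neg_mem' := by
    rintro a ⟨ha, ha'⟩
    exact ⟨by simp [ha], by simp [ha']⟩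
  inv_mem' := by
    rintro a ⟨ha, ha'⟩
    refine ⟨by simp [ha], ?_⟩
    by_cases h0 : a = 0
    · subst h0
      simp
    · have h := δ.leibniz a a⁻¹
      rw [mul_inv_cancel₀ h0, δ.map_one, ha', ha] at h
      simpa [h0] using h.symm

/-- The Ore polynomials `K[X; θ, δ]`: finite formal sums `∑ aᵢ Xⁱ` with coefficients written
on the left, added coefficientwise. The product is given below. -/
def OrePolynomial {K : Type*} [Field K] (θ : K →+* K) (_δ : TwistedDerivation θ) : Type _ :=
  ℕ →₀ K

namespace OrePolynomial

section Ring

variable {K : Type*} [Field K] {θ : K →+* K} {δ : TwistedDerivation θ}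

instance : AddCommGroup (OrePolynomial θ δ) := inferInstanceAs (AddCommGroup (ℕ →₀ K))

/-- Scalar multiplication on the left, `a • ∑ aᵢ Xⁱ = ∑ a aᵢ Xⁱ`. -/
instance : Module K (OrePolynomial θ δ) := inferInstanceAs (Module K (ℕ →₀ K))

/-- The coefficient of `Xⁱ`. -/
def coeff (P : OrePolynomial θ δ) (i : ℕ) : K := (show ℕ →₀ K from P) i

/-- The finite set of exponents with nonzero coefficient. -/
def support (P : OrePolynomial θ δ) : Finset ℕ := (show ℕ →₀ K from P).support

variable (θ δ) in
/-- The monomial `a Xⁱ`, additive in `a`. -/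
def monomial (i : ℕ) : K →+ OrePolynomial θ δ :=
  (Finsupp.singleAddHom i : K →+ (ℕ →₀ K))

variable (θ δ) in
/-- The constant polynomial `a`. -/
def C (a : K) : OrePolynomial θ δ := monomial θ δ 0 a

variable (θ δ) in
/-- The variable. -/
def X : OrePolynomial θ δ := monomial θ δ 1 1

instance : One (OrePolynomial θ δ) := ⟨C θ δ 1⟩

theorem smul_monomial (a b : K) (i : ℕ) :
    a • monomial θ δ i b = monomial θ δ i (a * b) :=
  Finsupp.smul_single a i b

@[elab_as_elim]
theorem induction_on {p : OrePolynomial θ δ → Prop} (P : OrePolynomial θ δ) (h0 : p 0)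
    (hadd : ∀ P Q, p P → p Q → p (P + Q)) (hmon : ∀ i a, p (monomial θ δ i a)) : p P :=
  Finsupp.induction_linear (motive := p) P h0 hadd hmon

/-- For an additive endomorphism `u` of a `K`-vector space `M` and `P = ∑ aᵢ Xⁱ`, the
additive endomorphism `P(u) = ∑ aᵢ uⁱ`; it is additive in `P`. -/
def evalAdd {M : Type*} [AddCommGroup M] [Module K M] (u : AddMonoid.End M) :
    OrePolynomial θ δ →+ AddMonoid.End M :=
  (Finsupp.liftAddHom (fun i : ℕ =>
    (AddMonoidHom.mulRight (u ^ i)).comp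
      (Module.toAddMonoidEnd K M : K →+ AddMonoid.End M)) : (ℕ →₀ K) →+ AddMonoid.End M)

theorem evalAdd_monomial {M : Type*} [AddCommGroup M] [Module K M] (u : AddMonoid.End M)
    (i : ℕ) (a : K) (x : M) : evalAdd u (monomial θ δ i a) x = a • (u ^ i) x := by
  unfold evalAdd monomial
  erw [Finsupp.liftAddHom_apply_single]
  rfl

theorem evalAdd_add {M : Type*} [AddCommGroup M] [Module K M] (u : AddMonoid.End M)
    (P Q : OrePolynomial θ δ) (x : M) :
    evalAdd u (P + Q) x = evalAdd u P x + evalAdd u Q x := by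
  rw [map_add]
  rfl

variable (θ δ) in
/-- Left multiplication by `X`: the additive map with `a Xⁱ ↦ θ a Xⁱ⁺¹ + δ a Xⁱ`. -/
def mulXLeft : AddMonoid.End (OrePolynomial θ δ) :=
  (Finsupp.liftAddHom (fun i : ℕ =>
    ((monomial θ δ (i + 1)).comp θ.toAddMonoidHom + (monomial θ δ i).comp δ.toAddMonoidHom)) :
      (ℕ →₀ K) →+ OrePolynomial θ δ)

theorem mulXLeft_monomial (i : ℕ) (a : K) :
    mulXLeft θ δ (monomial θ δ i a) = monomial θ δ (i + 1) (θ a) + monomial θ δ i (δ a) := by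
  unfold mulXLeft
  exact Finsupp.liftAddHom_apply_single _ i a

theorem mulXLeft_smul (a : K) (P : OrePolynomial θ δ) :
    mulXLeft θ δ (a • P) = θ a • mulXLeft θ δ P + δ a • P := by
  induction P using induction_on with
  | h0 => simp
  | hadd P Q hP hQ => rw [smul_add, map_add, hP, hQ, map_add, smul_add, smul_add]; abel
  | hmon i b =>
    simp only [smul_monomial, mulXLeft_monomial, smul_add, map_mul, δ.leibniz, map_add]
    abel

/-- The product `(∑ aᵢ Xⁱ) * Q = ∑ aᵢ Xⁱ Q`, where `X` acts by `mulXLeft`. -/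
instance : Mul (OrePolynomial θ δ) := ⟨fun P Q => evalAdd (mulXLeft θ δ) P Q⟩

theorem mul_def (P Q : OrePolynomial θ δ) : P * Q = evalAdd (mulXLeft θ δ) P Q := rfl

theorem monomial_mul (i : ℕ) (a : K) (Q : OrePolynomial θ δ) :
    monomial θ δ i a * Q = a • (mulXLeft θ δ ^ i) Q :=
  evalAdd_monomial _ i a Q

theorem C_mul (a : K) (Q : OrePolynomial θ δ) : C θ δ a * Q = a • Q := by
  unfold C; rw [monomial_mul]; simp

theorem X_mul (Q : OrePolynomial θ δ) : X θ δ * Q = mulXLeft θ δ Q := by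
  unfold X; rw [monomial_mul]; simp

protected theorem add_mul' (P Q R : OrePolynomial θ δ) : (P + Q) * R = P * R + Q * R :=
  evalAdd_add _ P Q R

protected theorem mul_add' (P Q R : OrePolynomial θ δ) : P * (Q + R) = P * Q + P * R := by
  simp [mul_def]

/-- If `u` is pseudo-linear, then `P ↦ P(u)` is multiplicative. -/
theorem evalAdd_mul {M : Type*} [AddCommGroup M] [Module K M] (u : AddMonoid.End M)
    (hu : ∀ (a : K) (x : M), u (a • x) = θ a • u x + δ a • x)
    (P Q : OrePolynomial θ δ) (x : M) :
    evalAdd u (P * Q) x = evalAdd u P (evalAdd u Q x) := by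
  have hsmul : ∀ (a : K) (R : OrePolynomial θ δ) (y : M),
      evalAdd u (a • R) y = a • evalAdd u R y := by
    intro a R y
    induction R using induction_on with
    | h0 => simp
    | hadd P Q hP hQ => simp only [smul_add, evalAdd_add, hP, hQ]
    | hmon i b => rw [smul_monomial, evalAdd_monomial, evalAdd_monomial, mul_smul]
  have hX : ∀ (R : OrePolynomial θ δ) (y : M),
      evalAdd u (mulXLeft θ δ R) y = u (evalAdd u R y) := by
    intro R y
    induction R using induction_on with
    | h0 => simp
    | hadd P Q hP hQ => simp only [map_add (mulXLeft θ δ), evalAdd_add, hP, hQ, map_add u]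
    | hmon i b =>
      rw [mulXLeft_monomial, evalAdd_add, evalAdd_monomial,
        evalAdd_monomial, evalAdd_monomial, hu, pow_succ']
      rfl
  have hXi : ∀ (i : ℕ) (R : OrePolynomial θ δ) (y : M),
      evalAdd u ((mulXLeft θ δ ^ i) R) y = (u ^ i) (evalAdd u R y) := by
    intro i
    induction i with
    | zero => intro R y; simp
    | succ i ih =>
      intro R y
      rw [pow_succ', pow_succ']
      change evalAdd u (mulXLeft θ δ ((mulXLeft θ δ ^ i) R)) y = u ((u ^ i) (evalAdd u R y))
      rw [hX, ih]
  induction P using induction_on with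
  | h0 => simp [mul_def]
  | hadd P R hP hR =>
    rw [OrePolynomial.add_mul', evalAdd_add, evalAdd_add, hP, hR]
  | hmon i b => rw [monomial_mul, hsmul, hXi, evalAdd_monomial]

theorem monomial_eq_smul_pow (i : ℕ) (a : K) :
    monomial θ δ i a = a • (mulXLeft θ δ ^ i) (C θ δ 1) := by
  have h : ∀ i : ℕ, (mulXLeft θ δ ^ i) (C θ δ 1) = monomial θ δ i 1 := by
    intro i
    induction i with
    | zero => rfl
    | succ i ih =>
      rw [pow_succ']
      change mulXLeft θ δ ((mulXLeft θ δ ^ i) (C θ δ 1)) = _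
      rw [ih, mulXLeft_monomial, map_one, δ.map_one]
      simp
  rw [h, smul_monomial, mul_one]

instance : Ring (OrePolynomial θ δ) :=
  { (inferInstance : AddCommGroup (OrePolynomial θ δ)),
    (inferInstance : Mul (OrePolynomial θ δ)),
    (inferInstance : One (OrePolynomial θ δ)) with
    left_distrib := OrePolynomial.mul_add'
    right_distrib := OrePolynomial.add_mul'
    zero_mul := fun P => by simp [mul_def]
    mul_zero := fun P => by simp [mul_def]
    mul_assoc := fun P Q R => evalAdd_mul (mulXLeft θ δ) mulXLeft_smul P Q R
    one_mul := fun P => by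
      change C θ δ 1 * P = P
      rw [C_mul, one_smul]
    mul_one := fun P => by
      change P * C θ δ 1 = P
      induction P using induction_on with
      | h0 => simp [mul_def]
      | hadd P Q hP hQ => rw [OrePolynomial.add_mul', hP, hQ]
      | hmon i a => rw [monomial_mul, ← monomial_eq_smul_pow] }

/-- The defining commutation rule `X a = θ(a) X + δ(a)`. -/
theorem X_mul_C (a : K) :
    X θ δ * C θ δ a = C θ δ (θ a) * X θ δ + C θ δ (δ a) := by
  rw [X_mul, C_mul]
  unfold C X
  rw [mulXLeft_monomial, smul_monomial, mul_one]

/-- The degree, with the degree of `0` set to `0`. -/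
def natDegree (P : OrePolynomial θ δ) : ℕ := P.support.sup id

/-- The coefficient in the top degree is `1`. -/
def Monic (P : OrePolynomial θ δ) : Prop := P.coeff P.natDegree = 1

/-- The Ore polynomials of degree `< k`, with `0` included. -/
def degreeLT (θ : K →+* K) (δ : TwistedDerivation θ) (k : ℕ) :
    Submodule K (OrePolynomial θ δ) where
  carrier := {P | ∀ i, k ≤ i → P.coeff i = 0}
  zero_mem' := fun _ _ => rfl
  add_mem' := by
    intro P Q hP hQ i hi
    change P.coeff i + Q.coeff i = 0
    rw [hP i hi, hQ i hi, add_zero]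
  smul_mem' := by
    intro a P hP i hi
    change a * P.coeff i = 0
    rw [hP i hi, mul_zero]

/-- Right Euclidean division by `X - c`: existence and uniqueness of the remainder. -/
theorem existsUnique_remainder (P : OrePolynomial θ δ) (c : K) :
    ∃! r : K, ∃ Q : OrePolynomial θ δ, P = Q * (X θ δ - C θ δ c) + C θ δ r := by
  have hCadd : ∀ a b : K, C θ δ (a + b) = C θ δ a + C θ δ b := fun a b => map_add _ a b
  have hCmul : ∀ a b : K, C θ δ a * C θ δ b = C θ δ (a * b) := fun a b => by
    rw [C_mul]; unfold C; rw [smul_monomial]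
  refine existsUnique_of_exists_of_unique ?_ ?_
  · have hX : ∀ R : OrePolynomial θ δ,
        (∃ r : K, ∃ Q : OrePolynomial θ δ, R = Q * (X θ δ - C θ δ c) + C θ δ r) →
        ∃ r : K, ∃ Q : OrePolynomial θ δ,
          X θ δ * R = Q * (X θ δ - C θ δ c) + C θ δ r := by
      rintro R ⟨r, Q, rfl⟩
      refine ⟨θ r * c + δ r, X θ δ * Q + C θ δ (θ r), ?_⟩
      rw [mul_add, X_mul_C, hCadd, ← hCmul]
      noncomm_ring
    induction P using induction_on with
    | h0 => exact ⟨0, 0, by simp [C]⟩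
    | hadd P Q hP hQ =>
      obtain ⟨r, A, rfl⟩ := hP
      obtain ⟨s, B, rfl⟩ := hQ
      exact ⟨r + s, A + B, by rw [hCadd, add_mul]; abel⟩
    | hmon i a =>
      have hpow : ∃ r : K, ∃ Q : OrePolynomial θ δ,
          (mulXLeft θ δ ^ i) (C θ δ 1) = Q * (X θ δ - C θ δ c) + C θ δ r := by
        induction i with
        | zero => exact ⟨1, 0, by simp⟩
        | succ i ih =>
          have h := hX _ ih
          rw [X_mul] at h
          rw [pow_succ']
          exact h
      obtain ⟨r, Q, h⟩ := hpow
      refine ⟨a * r, C θ δ a * Q, ?_⟩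
      rw [monomial_eq_smul_pow, h, ← C_mul, mul_add, hCmul, mul_assoc]
  · let u : AddMonoid.End K := δ.toAddMonoidHom + (AddMonoidHom.mulLeft c).comp θ.toAddMonoidHom
    have hu : ∀ a x : K, u (a • x) = θ a • u x + δ a • x := by
      intro a x
      change δ (a * x) + c * θ (a * x) = θ a * (δ x + c * θ x) + δ a * x
      rw [δ.leibniz, map_mul]
      ring
    have hC : ∀ r x : K, evalAdd (θ := θ) (δ := δ) u (C θ δ r) x = r * x := by
      intro r x
      unfold C
      rw [evalAdd_monomial]
      simp
    have h1 : evalAdd (θ := θ) (δ := δ) u (X θ δ - C θ δ c) 1 = 0 := by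
      rw [map_sub]
      change evalAdd u (X θ δ) (1 : K) - evalAdd u (C θ δ c) (1 : K) = 0
      rw [hC]
      unfold X
      rw [evalAdd_monomial]
      change (1 : K) * (δ 1 + c * θ 1) - c * 1 = 0
      rw [δ.map_one, map_one]
      ring
    have key : ∀ r : K, (∃ Q : OrePolynomial θ δ, P = Q * (X θ δ - C θ δ c) + C θ δ r) →
        evalAdd u P (1 : K) = r := by
      rintro r ⟨Q, rfl⟩
      rw [evalAdd_add, evalAdd_mul u hu, h1, hC]
      simp
    intro r s hr hs
    rw [← key r hr, ← key s hs]

/-- The remainder of the right Euclidean division of `P` by `X - c`, i.e. the unique `r` in `K`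
with `P = Q (X - c) + r` for some `Q`. For a generator `Z` of the centre this is `υ(c)`. -/
def remainder (P : OrePolynomial θ δ) (c : K) : K := (existsUnique_remainder P c).choose

theorem remainder_spec (P : OrePolynomial θ δ) (c : K) :
    ∃ Q : OrePolynomial θ δ, P = Q * (X θ δ - C θ δ c) + C θ δ (P.remainder c) :=
  (existsUnique_remainder P c).choose_spec.1

/-- `Z` is monic and the centre of `K[X; θ, δ]` is `F[Z]`, the subring generated by `F`
and `Z`. -/
structure IsCentreGenerator (Z : OrePolynomial θ δ) : Prop where
  monic : Z.Monic
  centre_eq : Subring.center (OrePolynomial θ δ) =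
    Subring.closure (C θ δ '' (constantField θ δ : Set K) ∪ {Z})

/-- The usual normalization of `Z`: a linearized polynomial (only exponents `p ^ j`, with `p`
the characteristic of `K`) when `θ = id`, a power of a polynomial of degree `1` otherwise. -/
structure IsNormalized (Z : OrePolynomial θ δ) : Prop where
  linearized : θ = RingHom.id K →
    ∃ p : ℕ, p.Prime ∧ CharP K p ∧ ∀ i, Z.coeff i ≠ 0 → ∃ j, i = p ^ j
  power : θ ≠ RingHom.id K → ∃ (L : OrePolynomial θ δ) (e : ℕ), L.natDegree = 1 ∧ Z = L ^ e

end Ring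

end OrePolynomial

section Evaluation

variable {K : Type*} [Field K] (θ : K →+* K) (δ : TwistedDerivation θ)

/-- The pseudo-linear endomorphism `δ + c θ` of `K`, as an `F`-linear map. -/
def pseudoLinear (c : K) : Module.End (constantField θ δ) K where
  toFun x := δ x + c * θ x
  map_add' x y := by
    rw [map_add, map_add]
    ring
  map_smul' a x := by
    obtain ⟨a, ha, ha'⟩ := a
    change δ (a * x) + c * θ (a * x) = a * (δ x + c * θ x)
    rw [δ.leibniz, map_mul, ha, show δ a = 0 from ha']
    ring

/-- `c` is ramified if `δ + c θ` is a scalar multiple of the identity of `K`. -/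
def IsRamified (c : K) : Prop := ∃ a : K, ∀ x : K, pseudoLinear θ δ c x = a * x

/-- The evaluation map `ev_c`, sending `∑ aᵢ Xⁱ` to the endomorphism `∑ aᵢ (δ + c θ)ⁱ`. -/
def evalMap (c : K) : OrePolynomial θ δ →ₗ[K] Module.End (constantField θ δ) K :=
  (Finsupp.lsum K (fun i : ℕ =>
    LinearMap.toSpanSingleton K (Module.End (constantField θ δ) K) (pseudoLinear θ δ c ^ i)) :
    (ℕ →₀ K) →ₗ[K] Module.End (constantField θ δ) K)

variable {θ δ} {m : ℕ}

/-- `Hom_F(V, K) = Hom_F(V₁, K) × ⋯ × Hom_F(Vₘ, K)`, a `K`-vector space through the codomain. -/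
abbrev HomTuple (V : Fin m → Submodule (constantField θ δ) K) : Type _ :=
  ∀ i, V i →ₗ[constantField θ δ] K

/-- `P ↦ (ev_{c₁}(P)|_{V₁}, …, ev_{cₘ}(P)|_{Vₘ})`. -/
def evalTuple (c : Fin m → K) (V : Fin m → Submodule (constantField θ δ) K) :
    OrePolynomial θ δ →ₗ[K] HomTuple V where
  toFun P i := (evalMap θ δ (c i) P).domRestrict (V i)
  map_add' P Q := by
    ext i x
    simp
  map_smul' a P := by
    ext i x
    simp

/-- The linearized Reed-Solomon code: the image of the Ore polynomials of degree `< k`. -/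
def LRS (k : ℕ) (c : Fin m → K) (V : Fin m → Submodule (constantField θ δ) K) :
    Submodule K (HomTuple V) :=
  (OrePolynomial.degreeLT θ δ k).map (evalTuple c V)

/-- The sum-rank weight. -/
def sumRankWeight {V : Fin m → Submodule (constantField θ δ) K} (φ : HomTuple V) : ℕ :=
  ∑ i, Module.finrank (constantField θ δ) (LinearMap.range (φ i))

/-- The length of a code, i.e. of a `K`-linear subspace of `Hom_F(V, K)`. -/
def codeLength {V : Fin m → Submodule (constantField θ δ) K}
    (_C : Submodule K (HomTuple V)) : ℕ :=
  ∑ i, Module.finrank (constantField θ δ) (V i)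

/-- `d` is the minimum sum-rank distance of the code: the least sum-rank weight of a nonzero
codeword. The zero code has no minimum distance. -/
def HasMinDist {V : Fin m → Submodule (constantField θ δ) K}
    (C : Submodule K (HomTuple V)) (d : ℕ) : Prop :=
  IsLeast {w | ∃ φ ∈ C, φ ≠ 0 ∧ sumRankWeight φ = w} d

/-- Maximum sum-rank distance: the code attains the Singleton bound
`dimension + distance ≤ length + 1`. -/
def IsMSRD {V : Fin m → Submodule (constantField θ δ) K}
    (C : Submodule K (HomTuple V)) : Prop :=
  ∃ d, HasMinDist C d ∧ Module.finrank K C + d = codeLength C + 1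

end Evaluation

end

/-! ### Degrees, division and central elements in `K[X; θ, δ]` -/

namespace OrePolynomial

variable {K : Type*} [Field K] {θ : K →+* K} {δ : TwistedDerivation θ}

/-! The heart is a root count: for `P ≠ 0` of degree at most `d`, the kernels of the `ev_{c_i}(P)`
have total `F`-dimension at most `d` (`sum_finrank_ker_evalMap_le`). By rank-nullity, a nonzero `P`
of degree `< k` gives a word of weight at least `n - k + 1 > 0`. So evaluation is injective in these
degrees and the dimension is `k`. Solving `k - 1` linear equations in `k` coefficients yields a word
attaining the bound.

For the root count, let `x ≠ 0` be killed by `ev_{c_i}(P)` and write `(δ + c_i θ) x = b x`. Then `P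
= Q (X - b)`, and `X - b` contributes at most 1. Its kernel at an unramified point is at most an
`F`-line. If it has a nonzero kernel vector `y` at `c_j`, then multiplication by `y` intertwines
`ev_b` and `ev_{c_j}`. The central `Z` acts there by the scalars `υ(b)` and `υ(c_j)`, which
therefore agree, so only one `j` can occur.

For the centre, suppose first `θ ≠ id`. Then `δ = t (θ - id)`, so `L = X + t` satisfies `L a = θ(a)
L`, and `Z = L ^ r` with `r` the order of `θ`. If `θ = id`, take `Z` monic of least degree with
`Z(δ) = 0`. Its commutators with constants and with `X` have lower degree and still vanish at `δ`,
hence are zero. A central polynomial minus its constant term is a multiple of `Z`. Coefficients in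
`b Z = Z b` force `Z` to be linearized. -/

theorem ext_coeff {P Q : OrePolynomial θ δ} (h : ∀ i, P.coeff i = Q.coeff i) : P = Q :=
  Finsupp.ext h

@[simp] theorem coeff_zero (i : ℕ) : (0 : OrePolynomial θ δ).coeff i = 0 := rfl

@[simp] theorem coeff_add (P Q : OrePolynomial θ δ) (i : ℕ) :
    (P + Q).coeff i = P.coeff i + Q.coeff i := rfl

@[simp] theorem coeff_sub (P Q : OrePolynomial θ δ) (i : ℕ) :
    (P - Q).coeff i = P.coeff i - Q.coeff i := rfl

@[simp] theorem coeff_smul (a : K) (P : OrePolynomial θ δ) (i : ℕ) :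
    (a • P).coeff i = a * P.coeff i := rfl

theorem coeff_monomial (i j : ℕ) (a : K) :
    (monomial θ δ i a).coeff j = if i = j then a else 0 :=
  Finsupp.single_apply

theorem coeff_C (a : K) (j : ℕ) : (C θ δ a).coeff j = if 0 = j then a else 0 :=
  coeff_monomial 0 j a

theorem C_add (a b : K) : C θ δ (a + b) = C θ δ a + C θ δ b := map_add _ a b

theorem C_sub (a b : K) : C θ δ (a - b) = C θ δ a - C θ δ b := map_sub _ a b

theorem C_mul_C (a b : K) : C θ δ a * C θ δ b = C θ δ (a * b) := by
  rw [C_mul]; exact smul_monomial a b 0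

theorem C_zero : C θ δ 0 = 0 := map_zero _

theorem C_one : C θ δ 1 = 1 := rfl

theorem degreeLT_mono {k l : ℕ} (h : k ≤ l) : degreeLT θ δ k ≤ degreeLT θ δ l :=
  fun _ hP i hi => hP i (h.trans hi)

theorem C_mem_degreeLT (a : K) : C θ δ a ∈ degreeLT θ δ 1 := by
  intro i hi
  rw [coeff_C, if_neg (by omega)]

theorem C_mem_degreeLT_of_pos {k : ℕ} (hk : 1 ≤ k) (a : K) : C θ δ a ∈ degreeLT θ δ k :=
  degreeLT_mono hk (C_mem_degreeLT a)

theorem eq_zero_of_mem_degreeLT_zero {P : OrePolynomial θ δ} (h : P ∈ degreeLT θ δ 0) : P = 0 :=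
  ext_coeff fun i => h i i.zero_le

theorem eq_C_of_mem_degreeLT_one {P : OrePolynomial θ δ} (h : P ∈ degreeLT θ δ 1) :
    P = C θ δ (P.coeff 0) := by
  refine ext_coeff fun i => ?_
  rw [coeff_C]
  split_ifs with hi
  · rw [hi]
  · exact h i (by omega)

/-- A polynomial of degree `≤ n` without term in degree `n` has degree `< n`. -/
theorem mem_degreeLT_of_coeff_eq_zero {n : ℕ} {P : OrePolynomial θ δ}
    (h : P ∈ degreeLT θ δ (n + 1)) (h0 : P.coeff n = 0) : P ∈ degreeLT θ δ n := by
  intro i hi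
  rcases hi.eq_or_lt with rfl | hi
  · exact h0
  · exact h i hi

theorem mem_degreeLT_natDegree_succ (P : OrePolynomial θ δ) :
    P ∈ degreeLT θ δ (P.natDegree + 1) := by
  intro i hi
  by_contra h
  have : i ≤ P.natDegree := Finset.le_sup (f := id) (Finsupp.mem_support_iff.2 h)
  omega

theorem natDegree_eq {n : ℕ} {P : OrePolynomial θ δ} (h : P ∈ degreeLT θ δ (n + 1))
    (h0 : P.coeff n ≠ 0) : P.natDegree = n := by
  refine le_antisymm (Finset.sup_le fun i hi => ?_)
    (Finset.le_sup (f := id) (Finsupp.mem_support_iff.2 h0))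
  by_contra hlt
  exact Finsupp.mem_support_iff.1 hi (h i (by simpa using hlt))

theorem coeff_natDegree_ne_zero {P : OrePolynomial θ δ} (h : P ≠ 0) :
    P.coeff P.natDegree ≠ 0 := by
  have hs : P.support.Nonempty := Finsupp.support_nonempty_iff.2 h
  obtain ⟨i, hi, hi'⟩ := Finset.exists_mem_eq_sup P.support hs id
  have : P.natDegree = i := hi'
  rw [this]
  exact Finsupp.mem_support_iff.1 hi

theorem eq_sum_monomial {n : ℕ} {P : OrePolynomial θ δ} (h : P ∈ degreeLT θ δ n) :
    P = ∑ i ∈ Finset.range n, monomial θ δ i (P.coeff i) := by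
  have hs : P.support ⊆ Finset.range n := by
    intro i hi
    by_contra hn
    exact Finsupp.mem_support_iff.1 hi (h i (by simpa using hn))
  have h1 : (Finsupp.sum P Finsupp.single : ℕ →₀ K) = P := Finsupp.sum_single P
  rw [Finsupp.sum_of_support_subset P hs _ (fun i _ => Finsupp.single_zero i)] at h1
  exact h1.symm

/-- The coefficient functional. -/
def coeffHom (θ : K →+* K) (δ : TwistedDerivation θ) (i : ℕ) : OrePolynomial θ δ →ₗ[K] K :=
  (Finsupp.lapply i : (ℕ →₀ K) →ₗ[K] K)

theorem coeff_sum {ι : Type*} (s : Finset ι) (f : ι → OrePolynomial θ δ) (k : ℕ) :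
    (∑ i ∈ s, f i).coeff k = ∑ i ∈ s, (f i).coeff k :=
  map_sum (coeffHom θ δ k) f s

theorem mul_eq_sum {n : ℕ} {P : OrePolynomial θ δ} (h : P ∈ degreeLT θ δ n)
    (Q : OrePolynomial θ δ) :
    P * Q = ∑ i ∈ Finset.range n, P.coeff i • (mulXLeft θ δ ^ i) Q := by
  conv_lhs => rw [eq_sum_monomial h]
  rw [Finset.sum_mul]
  simp only [monomial_mul]

theorem coeff_mulXLeft_succ (Q : OrePolynomial θ δ) (k : ℕ) :
    (mulXLeft θ δ Q).coeff (k + 1) = θ (Q.coeff k) + δ (Q.coeff (k + 1)) := by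
  induction Q using induction_on with
  | h0 => simp
  | hadd P Q hP hQ => simp only [map_add, coeff_add, hP, hQ]; ring
  | hmon i a =>
    rw [mulXLeft_monomial, coeff_add]
    simp only [coeff_monomial, add_left_inj]
    split_ifs <;> simp

theorem coeff_mulXLeft_zero (Q : OrePolynomial θ δ) :
    (mulXLeft θ δ Q).coeff 0 = δ (Q.coeff 0) := by
  induction Q using induction_on with
  | h0 => simp
  | hadd P Q hP hQ => simp only [map_add, coeff_add, hP, hQ]
  | hmon i a =>
    rw [mulXLeft_monomial, coeff_add]
    simp only [coeff_monomial]
    split_ifs <;> simp_all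

/-- Only the `θ`-part of `X a = θ(a) X + δ(a)` raises the degree, so each factor `X` moves the top
coefficient up by one and applies `θ` to it. -/
theorem mulXLeft_pow_top {m : ℕ} {Q : OrePolynomial θ δ} (hQ : Q ∈ degreeLT θ δ (m + 1))
    (i : ℕ) : (mulXLeft θ δ ^ i) Q ∈ degreeLT θ δ (m + i + 1) ∧
      ((mulXLeft θ δ ^ i) Q).coeff (m + i) = (θ ^ i) (Q.coeff m) := by
  induction i with
  | zero => exact ⟨hQ, rfl⟩
  | succ i ih =>
    rw [pow_succ']
    obtain ⟨h1, h2⟩ := ih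
    refine ⟨fun k hk => ?_, ?_⟩
    · obtain ⟨k, rfl⟩ : ∃ l, k = l + 1 := ⟨k - 1, by omega⟩
      change (mulXLeft θ δ ((mulXLeft θ δ ^ i) Q)).coeff (k + 1) = 0
      rw [coeff_mulXLeft_succ, h1 k (by omega), h1 (k + 1) (by omega)]
      simp
    · change (mulXLeft θ δ ((mulXLeft θ δ ^ i) Q)).coeff (m + i + 1) = _
      rw [coeff_mulXLeft_succ, h2, h1 (m + i + 1) (by omega), pow_succ']
      simp

/-- Degree and top coefficient of a product. -/
theorem mul_top {n m : ℕ} {P Q : OrePolynomial θ δ} (hP : P ∈ degreeLT θ δ (n + 1))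
    (hQ : Q ∈ degreeLT θ δ (m + 1)) :
    P * Q ∈ degreeLT θ δ (n + m + 1) ∧
      (P * Q).coeff (n + m) = P.coeff n * (θ ^ n) (Q.coeff m) := by
  rw [mul_eq_sum hP]
  constructor
  · refine Submodule.sum_mem _ fun i hi => Submodule.smul_mem _ _ ?_
    exact degreeLT_mono (by simp at hi; omega) (mulXLeft_pow_top hQ i).1
  · rw [coeff_sum, Finset.sum_range_succ, Finset.sum_eq_zero, zero_add, coeff_smul, add_comm n m,
      (mulXLeft_pow_top hQ n).2]
    intro i hi
    rw [coeff_smul, (mulXLeft_pow_top hQ i).1 _ (by simp at hi; omega), mul_zero]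

/-- Degrees add because `θ`, a homomorphism of fields, is injective and cannot kill a top
coefficient. -/
theorem coeff_top_mul_ne_zero {P Q : OrePolynomial θ δ} (hP : P ≠ 0) (hQ : Q ≠ 0) :
    (P * Q).coeff (P.natDegree + Q.natDegree) ≠ 0 := by
  rw [(mul_top P.mem_degreeLT_natDegree_succ Q.mem_degreeLT_natDegree_succ).2]
  exact mul_ne_zero (coeff_natDegree_ne_zero hP)
    ((map_ne_zero _).2 (coeff_natDegree_ne_zero hQ))

instance : NoZeroDivisors (OrePolynomial θ δ) where
  eq_zero_or_eq_zero_of_mul_eq_zero := by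
    intro P Q h
    by_contra! hne
    exact coeff_top_mul_ne_zero hne.1 hne.2 (by rw [h]; rfl)

theorem natDegree_add_le_of_mul_mem {P Q : OrePolynomial θ δ} (hP : P ≠ 0) (hQ : Q ≠ 0) {d : ℕ}
    (h : P * Q ∈ degreeLT θ δ (d + 1)) : P.natDegree + Q.natDegree ≤ d := by
  by_contra! hlt
  exact coeff_top_mul_ne_zero hP hQ (h _ hlt)

theorem pow_top {n : ℕ} {P : OrePolynomial θ δ} (hP : P ∈ degreeLT θ δ (n + 1))
    (h1 : P.coeff n = 1) (e : ℕ) :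
    P ^ e ∈ degreeLT θ δ (e * n + 1) ∧ (P ^ e).coeff (e * n) = 1 := by
  induction e with
  | zero =>
    rw [pow_zero, ← C_one, zero_mul]
    exact ⟨C_mem_degreeLT 1, by simp [coeff_C]⟩
  | succ e ih =>
    have h := mul_top ih.1 hP
    rw [pow_succ, add_mul, one_mul]
    exact ⟨h.1, by rw [h.2, ih.2, h1]; simp⟩

theorem X_sub_C_mem (c : K) : X θ δ - C θ δ c ∈ degreeLT θ δ (1 + 1) := by
  intro i hi
  rw [coeff_sub, coeff_C]
  unfold X
  rw [coeff_monomial, if_neg (by omega), if_neg (by omega), sub_zero]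

theorem coeff_X_sub_C (c : K) : (X θ δ - C θ δ c).coeff 1 = 1 := by
  rw [coeff_sub, coeff_C]
  unfold X
  rw [coeff_monomial]
  simp

theorem natDegree_X_sub_C (c : K) : (X θ δ - C θ δ c).natDegree = 1 :=
  natDegree_eq (X_sub_C_mem c) (by rw [coeff_X_sub_C]; exact one_ne_zero)

theorem X_sub_C_ne_zero (c : K) : X θ δ - C θ δ c ≠ 0 := by
  intro h
  have := coeff_X_sub_C (θ := θ) (δ := δ) c
  rw [h] at this
  simp at this

theorem eq_mul_X_sub_C_add (P : OrePolynomial θ δ) (c : K) :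
    ∃ (Q : OrePolynomial θ δ) (r : K), P = Q * (X θ δ - C θ δ c) + C θ δ r :=
  ⟨_, _, (remainder_spec P c).choose_spec⟩

/-- Right division by a monic polynomial. -/
theorem exists_eq_mul_add {d : ℕ} {Z : OrePolynomial θ δ} (hZ : Z ∈ degreeLT θ δ (d + 1))
    (h1 : Z.coeff d = 1) (P : OrePolynomial θ δ) :
    ∃ Q R, P = Q * Z + R ∧ R ∈ degreeLT θ δ d := by
  suffices h : ∀ (n : ℕ) (P : OrePolynomial θ δ), P ∈ degreeLT θ δ n →
      ∃ Q R, P = Q * Z + R ∧ R ∈ degreeLT θ δ d from h _ P P.mem_degreeLT_natDegree_succ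
  intro n
  induction n with
  | zero =>
    intro P hP
    exact ⟨0, P, by simp, degreeLT_mono d.zero_le hP⟩
  | succ n ih =>
    intro P hP
    by_cases hn : n < d
    · exact ⟨0, P, by simp, degreeLT_mono hn hP⟩
    · obtain ⟨q, rfl⟩ : ∃ q, n = q + d := ⟨n - d, by omega⟩
      have hm : monomial θ δ q (P.coeff (q + d)) ∈ degreeLT θ δ (q + 1) := by
        intro i hi
        rw [coeff_monomial, if_neg (by omega)]
      have ht := mul_top hm hZ
      obtain ⟨Q, R, h, hR⟩ := ih (P - monomial θ δ q (P.coeff (q + d)) * Z)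
        (mem_degreeLT_of_coeff_eq_zero (Submodule.sub_mem _ hP ht.1) (by
          rw [coeff_sub, ht.2, h1, coeff_monomial, if_pos rfl]; simp))
      refine ⟨Q + monomial θ δ q (P.coeff (q + d)), R, ?_, hR⟩
      rw [add_mul, add_right_comm, ← h, sub_add_cancel]

/-- An Ore polynomial commuting with the constants and the variable is central. -/
theorem mem_center_of_commute {P : OrePolynomial θ δ}
    (hC : ∀ a, C θ δ a * P = P * C θ δ a) (hX : X θ δ * P = P * X θ δ) :
    P ∈ Subring.center (OrePolynomial θ δ) := by
  rw [Subring.mem_center_iff]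
  intro Q
  induction Q using induction_on with
  | h0 => simp
  | hadd Q R hQ hR => rw [add_mul, mul_add, hQ, hR]
  | hmon i a =>
    have h : monomial θ δ i a = C θ δ a * X θ δ ^ i := by
      induction i with
      | zero => rw [pow_zero, mul_one]; rfl
      | succ i ih =>
        rw [C_mul] at ih ⊢
        have h1 : monomial θ δ i 1 = X θ δ ^ i := by
          rw [monomial_eq_smul_pow, one_smul]
          clear ih
          induction i with
          | zero => rfl
          | succ i ih => rw [pow_succ', pow_succ', ← ih, X_mul]; rfl
        rw [pow_succ', ← h1, X_mul, mulXLeft_monomial, map_one, δ.map_one, map_zero, add_zero,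
          smul_monomial, mul_one]
    rw [h]
    have hXi : X θ δ ^ i * P = P * X θ δ ^ i := Commute.pow_left hX i
    rw [mul_assoc, hXi, ← mul_assoc, hC, mul_assoc]

theorem C_mem_center {a : K} (ha : a ∈ constantField θ δ) :
    C θ δ a ∈ Subring.center (OrePolynomial θ δ) := by
  refine mem_center_of_commute (fun b => ?_) ?_
  · rw [C_mul_C, C_mul_C, mul_comm]
  · rw [X_mul_C, ha.1, show δ a = 0 from ha.2, C_zero, add_zero]

/-- Induction on the degree to show that the centre is `F[Z]`. -/
theorem center_eq_closure_of_reduction {Z : OrePolynomial θ δ}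
    (hZ : Z ∈ Subring.center (OrePolynomial θ δ))
    (hred : ∀ n, ∀ P ∈ Subring.center (OrePolynomial θ δ), P ∈ degreeLT θ δ (n + 1) →
      (∀ Q ∈ Subring.center (OrePolynomial θ δ), Q ∈ degreeLT θ δ n →
        Q ∈ Subring.closure (C θ δ '' (constantField θ δ : Set K) ∪ {Z})) →
      P ∈ Subring.closure (C θ δ '' (constantField θ δ : Set K) ∪ {Z})) :
    Subring.center (OrePolynomial θ δ) =
      Subring.closure (C θ δ '' (constantField θ δ : Set K) ∪ {Z}) := by
  apply le_antisymm
  · suffices h : ∀ n, ∀ P ∈ Subring.center (OrePolynomial θ δ), P ∈ degreeLT θ δ n →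
        P ∈ Subring.closure (C θ δ '' (constantField θ δ : Set K) ∪ {Z}) from
      fun P hP => h _ P hP P.mem_degreeLT_natDegree_succ
    intro n
    induction n with
    | zero =>
      intro P _ h
      rw [eq_zero_of_mem_degreeLT_zero h]
      exact Subring.zero_mem _
    | succ n ih => exact fun P hP h => hred n P hP h ih
  · rw [Subring.closure_le]
    rintro _ (⟨a, ha, rfl⟩ | h)
    · exact C_mem_center ha
    · rw [Set.mem_singleton_iff.1 h]
      exact hZ

end OrePolynomial

/-! ### Evaluation, eigenvectors and the root count -/

section Evaluation

open OrePolynomial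

variable {K : Type*} [Field K] {θ : K →+* K} {δ : TwistedDerivation θ}

theorem pseudoLinear_apply (c x : K) : pseudoLinear θ δ c x = δ x + c * θ x := rfl

/-- The relation `X a = θ(a) X + δ(a)`, read in endomorphisms of `K`; it makes evaluation at `c`
multiplicative. -/
theorem pseudoLinear_mul (c a x : K) :
    pseudoLinear θ δ c (a * x) = θ a * pseudoLinear θ δ c x + δ a * x := by
  simp only [pseudoLinear_apply, δ.leibniz, map_mul]
  ring

theorem pseudoLinear_one (c : K) : pseudoLinear θ δ c 1 = c := by
  rw [pseudoLinear_apply, δ.map_one, map_one, zero_add, mul_one]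

theorem evalMap_monomial (c : K) (i : ℕ) (a : K) :
    evalMap θ δ c (monomial θ δ i a) = a • pseudoLinear θ δ c ^ i := by
  unfold evalMap monomial
  erw [Finsupp.lsum_single]
  rfl

theorem evalMap_C (c a x : K) : evalMap θ δ c (C θ δ a) x = a * x := by
  unfold C
  rw [evalMap_monomial, pow_zero]
  rfl

theorem evalMap_X (c : K) : evalMap θ δ c (X θ δ) = pseudoLinear θ δ c := by
  unfold X
  rw [evalMap_monomial, pow_one, one_smul]

theorem evalMap_mulXLeft (c : K) (P : OrePolynomial θ δ) :
    evalMap θ δ c (mulXLeft θ δ P) = pseudoLinear θ δ c * evalMap θ δ c P := by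
  induction P using induction_on with
  | h0 => simp
  | hadd P Q hP hQ => rw [map_add, map_add, hP, hQ, map_add, mul_add]
  | hmon i a =>
    rw [mulXLeft_monomial, map_add, evalMap_monomial, evalMap_monomial, evalMap_monomial, pow_succ']
    ext x
    exact (pseudoLinear_mul c a _).symm

theorem evalMap_mulXLeft_pow (c : K) (i : ℕ) (P : OrePolynomial θ δ) :
    evalMap θ δ c ((mulXLeft θ δ ^ i) P) = pseudoLinear θ δ c ^ i * evalMap θ δ c P := by
  induction i with
  | zero => rw [pow_zero, pow_zero, one_mul]; rfl
  | succ i ih =>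
    rw [pow_succ', pow_succ', mul_assoc, ← ih, ← evalMap_mulXLeft]
    rfl

theorem evalMap_mul (c : K) (P Q : OrePolynomial θ δ) :
    evalMap θ δ c (P * Q) = evalMap θ δ c P * evalMap θ δ c Q := by
  induction P using induction_on with
  | h0 => simp
  | hadd P R hP hR => rw [add_mul, map_add, hP, hR, map_add, add_mul]
  | hmon i a =>
    rw [monomial_mul, map_smul, evalMap_mulXLeft_pow, evalMap_monomial]
    rfl

theorem evalMap_X_sub_C (b c x : K) :
    evalMap θ δ b (X θ δ - C θ δ c) x = pseudoLinear θ δ b x - c * x := by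
  rw [map_sub, LinearMap.sub_apply, evalMap_X, evalMap_C]

/-- The remainder of the division by `X - c` is the value at `1` of the evaluation at `c`. -/
theorem remainder_eq_evalMap (P : OrePolynomial θ δ) (c : K) :
    P.remainder c = evalMap θ δ c P 1 := by
  obtain ⟨Q, hQ⟩ := remainder_spec P c
  conv_rhs => rw [hQ]
  rw [map_add, evalMap_mul, LinearMap.add_apply, Module.End.mul_apply, evalMap_X_sub_C, evalMap_C,
    pseudoLinear_one]
  simp

/-- If `x` is an eigenvector of `δ + b θ` with eigenvalue `c`, then multiplication by `x`
intertwines the evaluations at `c` and at `b`. -/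
theorem evalMap_mul_of_eigenvector {b c x : K} (h : pseudoLinear θ δ b x = c * x)
    (P : OrePolynomial θ δ) (z : K) :
    evalMap θ δ b P (z * x) = evalMap θ δ c P z * x := by
  have h1 : ∀ z, pseudoLinear θ δ b (z * x) = pseudoLinear θ δ c z * x := by
    intro z
    rw [pseudoLinear_mul, h, pseudoLinear_apply]
    ring
  induction P using induction_on with
  | h0 => simp
  | hadd P Q hP hQ => simp only [map_add, LinearMap.add_apply, hP, hQ, add_mul]
  | hmon i a =>
    have h2 : ∀ z, (pseudoLinear θ δ b ^ i) (z * x) = (pseudoLinear θ δ c ^ i) z * x := by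
      induction i with
      | zero => intro z; rfl
      | succ i ih =>
        intro z
        rw [pow_succ', pow_succ', Module.End.mul_apply, ih, h1]
        rfl
    rw [evalMap_monomial, evalMap_monomial]
    change a * _ = a * _ * x
    rw [h2, mul_assoc]

/-- A central polynomial evaluates to a scalar. -/
theorem evalMap_of_mem_center {Z : OrePolynomial θ δ}
    (hZ : Z ∈ Subring.center (OrePolynomial θ δ)) (c x : K) :
    evalMap θ δ c Z x = evalMap θ δ c Z 1 * x := by
  -- `Z` commutes with the constant `x`; both products are applied to `1`.
  have h := congrArg (fun P => evalMap θ δ c P 1) (Subring.mem_center_iff.1 hZ (C θ δ x))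
  simp only [evalMap_mul, Module.End.mul_apply, evalMap_C, mul_one] at h
  rw [← h, mul_comm]

/-- `Z` acts by a scalar at `b` and at `c`, and multiplication by `x` intertwines the two actions,
so the scalars agree. Thus `υ` tells apart the points at which a given `X - c` has a root. -/
theorem remainder_eq_of_eigenvector {Z : OrePolynomial θ δ}
    (hZ : Z ∈ Subring.center (OrePolynomial θ δ)) {b c x : K} (hx : x ≠ 0)
    (h : pseudoLinear θ δ b x = c * x) : Z.remainder b = Z.remainder c := by
  have h1 := evalMap_mul_of_eigenvector h Z 1
  rw [one_mul, evalMap_of_mem_center hZ] at h1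
  rw [remainder_eq_evalMap, remainder_eq_evalMap]
  exact mul_right_cancel₀ hx h1

/-- Compare the two Leibniz expansions of `δ (a b) = δ (b a)`. As soon as `θ` moves some `a`, this
makes `δ` a multiple of `θ - id`. -/
theorem TwistedDerivation.symmetry (δ : TwistedDerivation θ) (a b : K) :
    δ b * (θ a - a) = δ a * (θ b - b) := by
  have h1 := δ.leibniz a b
  rw [mul_comm a b, δ.leibniz] at h1
  linear_combination -h1

/-- At an unramified point the eigenspaces of `δ + b θ` are lines. -/
theorem div_mem_constantField_of_eigenvector {b c x y : K} (hb : ¬ IsRamified θ δ b)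
    (hx : x ≠ 0) (hx' : pseudoLinear θ δ b x = c * x) (hy : pseudoLinear θ δ b y = c * y) :
    y / x ∈ constantField θ δ := by
  have h1 := pseudoLinear_mul (θ := θ) (δ := δ) b (y / x) x
  rw [div_mul_cancel₀ y hx, hx', hy] at h1
  set z := y / x with hz
  have hyz : y = z * x := (div_mul_cancel₀ y hx).symm
  have h2 : c * (θ z - z) + δ z = 0 := by
    apply mul_right_cancel₀ hx
    rw [hyz] at h1
    linear_combination -h1
  by_cases hθ : θ z = z
  · exact ⟨hθ, by rw [hθ, sub_self, mul_zero, zero_add] at h2; exact h2⟩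
  -- If `θ` moves `z`, symmetry gives `δ = -c (θ - id)`, so `δ + c θ` is multiplication by `c`. The
  -- eigenvector equation then forces `b = c`, and `b` would be ramified.
  · exfalso
    have hδ : ∀ w, δ w = -c * (θ w - w) := by
      intro w
      apply mul_right_cancel₀ (sub_ne_zero.2 hθ)
      rw [δ.symmetry]
      linear_combination (θ w - w) * h2
    have hbc : b = c := by
      rw [pseudoLinear_apply, hδ] at hx'
      have : (b - c) * θ x = 0 := by linear_combination hx'
      exact sub_eq_zero.1 ((mul_eq_zero.1 this).resolve_right ((map_ne_zero θ).2 hx))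
    refine hb ⟨c, fun w => ?_⟩
    rw [pseudoLinear_apply, hδ, hbc]
    ring

theorem finrank_ker_X_sub_C_le_one {b : K} (hb : ¬ IsRamified θ δ b) (c : K) :
    Module.finrank (constantField θ δ)
      (LinearMap.ker (evalMap θ δ b (X θ δ - C θ δ c))) ≤ 1 := by
  by_cases h : ∃ x ∈ LinearMap.ker (evalMap θ δ b (X θ δ - C θ δ c)), x ≠ 0
  · obtain ⟨x, hx, hx0⟩ := h
    refine finrank_le_one ⟨x, hx⟩ fun ⟨y, hy⟩ => ?_
    rw [LinearMap.mem_ker, evalMap_X_sub_C, sub_eq_zero] at hx hy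
    exact ⟨⟨y / x, div_mem_constantField_of_eigenvector hb hx0 hx hy⟩,
      Subtype.ext (div_mul_cancel₀ y hx0)⟩
  · push Not at h
    rw [(Submodule.eq_bot_iff _).2 h, finrank_bot]
    exact zero_le_one

/-- `g` maps the kernel of `f * g` into the kernel of `f`, and what it kills lies in its own kernel.
-/
theorem finrank_ker_mul_le [FiniteDimensional (constantField θ δ) K]
    (f g : Module.End (constantField θ δ) K) :
    Module.finrank (constantField θ δ) (LinearMap.ker (f * g)) ≤
      Module.finrank (constantField θ δ) (LinearMap.ker f) +
        Module.finrank (constantField θ δ) (LinearMap.ker g) := by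
  set h := g.domRestrict (LinearMap.ker (f * g))
  have h1 := LinearMap.finrank_range_add_finrank_ker h
  have h2 : LinearMap.range h ≤ LinearMap.ker f := by
    rintro _ ⟨⟨x, hx⟩, rfl⟩
    exact hx
  have h3 : Module.finrank (constantField θ δ) (LinearMap.ker h) ≤
      Module.finrank (constantField θ δ) (LinearMap.ker g) := by
    rw [(Submodule.equivSubtypeMap _ (LinearMap.ker h)).finrank_eq]
    apply Submodule.finrank_mono
    rintro _ ⟨x, hx, rfl⟩
    exact hx
  have h4 := Submodule.finrank_mono h2
  omega

/-- The kernels of the evaluations of `P` at unramified points lying over distinct values of a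
central polynomial have total dimension at most the degree of `P`. -/
theorem sum_finrank_ker_evalMap_le [FiniteDimensional (constantField θ δ) K]
    {Z : OrePolynomial θ δ} (hZ : Z ∈ Subring.center (OrePolynomial θ δ))
    {m : ℕ} {c : Fin m → K} (hc : ∀ i, ¬ IsRamified θ δ (c i))
    (hdist : ∀ i j, i ≠ j → Z.remainder (c i) ≠ Z.remainder (c j))
    (d : ℕ) {P : OrePolynomial θ δ} (hP : P ≠ 0) (hd : P ∈ degreeLT θ δ (d + 1)) :
    ∑ i, Module.finrank (constantField θ δ) (LinearMap.ker (evalMap θ δ (c i) P)) ≤ d := by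
  induction d generalizing P with
  | zero =>
    refine (Finset.sum_eq_zero fun i _ => ?_).le
    rw [eq_C_of_mem_degreeLT_one hd]
    have h0 : P.coeff 0 ≠ 0 := by
      intro h0
      rw [eq_C_of_mem_degreeLT_one hd, h0, C_zero] at hP
      exact hP rfl
    rw [(LinearMap.ker_eq_bot').2, finrank_bot]
    intro x hx
    rw [evalMap_C] at hx
    exact (mul_eq_zero.1 hx).resolve_left h0
  | succ d ih =>
    by_cases h : ∃ i, ∃ x ∈ LinearMap.ker (evalMap θ δ (c i) P), x ≠ 0
    · obtain ⟨i, x, hx, hx0⟩ := h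
      set b := pseudoLinear θ δ (c i) x / x with hb
      have hbx : pseudoLinear θ δ (c i) x = b * x := (div_mul_cancel₀ _ hx0).symm
      obtain ⟨Q, r, hQ⟩ := eq_mul_X_sub_C_add P b
      -- Since `X - b` kills `x` at `c i`, applying `P = Q (X - b) + r` to `x` leaves `0 = r x`.
      have hr : r = 0 := by
        rw [LinearMap.mem_ker, hQ, map_add, evalMap_mul, LinearMap.add_apply,
          Module.End.mul_apply, evalMap_X_sub_C, hbx, sub_self, map_zero, zero_add,
          evalMap_C] at hx
        exact (mul_eq_zero.1 hx).resolve_right hx0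
      rw [hr, C_zero, add_zero] at hQ
      have hQ0 : Q ≠ 0 := by
        rintro rfl
        exact hP (by rw [hQ, zero_mul])
      have hle := natDegree_add_le_of_mul_mem hQ0 (X_sub_C_ne_zero b) (hQ ▸ hd)
      rw [natDegree_X_sub_C] at hle
      have hQd := ih hQ0 (degreeLT_mono (by omega) Q.mem_degreeLT_natDegree_succ)
      -- Only `j = i` contributes: a root of `X - b` at `c j` gives `υ(c j) = υ(b) = υ(c i)`.
      have hone : ∑ j, Module.finrank (constantField θ δ)
          (LinearMap.ker (evalMap θ δ (c j) (X θ δ - C θ δ b))) ≤ 1 := by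
        rw [Finset.sum_eq_single i]
        · exact finrank_ker_X_sub_C_le_one (hc i) b
        · intro j _ hji
          rw [(LinearMap.ker_eq_bot').2, finrank_bot]
          intro y hy
          by_contra hy0
          rw [evalMap_X_sub_C, sub_eq_zero] at hy
          exact hdist j i hji ((remainder_eq_of_eigenvector hZ hy0 hy).trans
            (remainder_eq_of_eigenvector hZ hx0 hbx).symm)
        · exact fun h => absurd (Finset.mem_univ i) h
      calc _ ≤ ∑ j, (Module.finrank (constantField θ δ)
              (LinearMap.ker (evalMap θ δ (c j) Q)) +
            Module.finrank (constantField θ δ)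
              (LinearMap.ker (evalMap θ δ (c j) (X θ δ - C θ δ b)))) := by
            refine Finset.sum_le_sum fun j _ => ?_
            rw [hQ, evalMap_mul]
            exact finrank_ker_mul_le _ _
        _ ≤ d + 1 := by
            rw [Finset.sum_add_distrib]
            exact add_le_add hQd hone
    · push Not at h
      refine (Finset.sum_eq_zero fun i _ => ?_).le.trans (Nat.zero_le _)
      rw [(Submodule.eq_bot_iff _).2 (h i), finrank_bot]

end Evaluation

/-! ### Dimension and minimum distance of the code -/

section Code

open OrePolynomial

variable {K : Type*} [Field K] {θ : K →+* K} {δ : TwistedDerivation θ} {m : ℕ}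

/-- The coefficients of a polynomial of degree `< k`. -/
noncomputable def degreeLTEquiv (θ : K →+* K) (δ : TwistedDerivation θ) (k : ℕ) :
    degreeLT θ δ k ≃ₗ[K] (Fin k → K) :=
  LinearEquiv.ofBijective (LinearMap.pi fun i : Fin k => (coeffHom θ δ i).domRestrict _) (by
    constructor
    · rw [injective_iff_map_eq_zero]
      rintro ⟨P, hP⟩ h
      refine Subtype.ext (ext_coeff fun i => ?_)
      by_cases hi : i < k
      · exact congrFun h ⟨i, hi⟩
      · exact hP i (by omega)
    · intro f
      refine ⟨⟨∑ i : Fin k, monomial θ δ i (f i), ?_⟩, ?_⟩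
      · refine Submodule.sum_mem _ fun i _ j hj => ?_
        rw [coeff_monomial, if_neg (by omega)]
      · ext j
        change (∑ i : Fin k, monomial θ δ i (f i)).coeff j = f j
        rw [coeff_sum]
        simp [coeff_monomial, Fin.val_inj])

instance (k : ℕ) : FiniteDimensional K (degreeLT θ δ k) :=
  Module.Finite.equiv (degreeLTEquiv θ δ k).symm

theorem finrank_degreeLT (k : ℕ) : Module.finrank K (degreeLT θ δ k) = k := by
  rw [(degreeLTEquiv θ δ k).finrank_eq, Module.finrank_fin_fun]

theorem sumRankWeight_add_sum_finrank_ker [FiniteDimensional (constantField θ δ) K]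
    {V : Fin m → Submodule (constantField θ δ) K} (φ : HomTuple V) :
    sumRankWeight φ + ∑ i, Module.finrank (constantField θ δ) (LinearMap.ker (φ i)) =
      ∑ i, Module.finrank (constantField θ δ) (V i) := by
  rw [sumRankWeight, ← Finset.sum_add_distrib]
  exact Finset.sum_congr rfl fun i _ => LinearMap.finrank_range_add_finrank_ker (φ i)

theorem finrank_ker_evalTuple_le [FiniteDimensional (constantField θ δ) K] (c : Fin m → K)
    (V : Fin m → Submodule (constantField θ δ) K) (P : OrePolynomial θ δ) (i : Fin m) :
    Module.finrank (constantField θ δ) (LinearMap.ker (evalTuple c V P i)) ≤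
      Module.finrank (constantField θ δ) (LinearMap.ker (evalMap θ δ (c i) P)) := by
  rw [(Submodule.equivSubtypeMap _ (LinearMap.ker (evalTuple c V P i))).finrank_eq]
  apply Submodule.finrank_mono
  rintro _ ⟨x, hx, rfl⟩
  exact hx

/-- A polynomial of degree `≤ d` evaluates to a codeword of weight at least `n - d`. -/
theorem length_le_sumRankWeight_add [FiniteDimensional (constantField θ δ) K]
    {Z : OrePolynomial θ δ} (hZ : Z ∈ Subring.center (OrePolynomial θ δ))
    {c : Fin m → K} (hc : ∀ i, ¬ IsRamified θ δ (c i))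
    (hdist : ∀ i j, i ≠ j → Z.remainder (c i) ≠ Z.remainder (c j))
    (V : Fin m → Submodule (constantField θ δ) K)
    (d : ℕ) {P : OrePolynomial θ δ} (hP : P ≠ 0) (hd : P ∈ degreeLT θ δ (d + 1)) :
    ∑ i, Module.finrank (constantField θ δ) (V i) ≤ sumRankWeight (evalTuple c V P) + d := by
  rw [← sumRankWeight_add_sum_finrank_ker (evalTuple c V P)]
  gcongr
  exact (Finset.sum_le_sum fun i _ => finrank_ker_evalTuple_le c V P i).trans
    (sum_finrank_ker_evalMap_le hZ hc hdist d hP hd)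

theorem sumRankWeight_zero {V : Fin m → Submodule (constantField θ δ) K} :
    sumRankWeight (0 : HomTuple V) = 0 := by
  refine Finset.sum_eq_zero fun i _ => ?_
  rw [Pi.zero_apply, LinearMap.range_zero, finrank_bot]

/-- Evaluation is injective on the polynomials of degree less than the length. -/
theorem eq_zero_of_evalTuple_eq_zero [FiniteDimensional (constantField θ δ) K]
    {Z : OrePolynomial θ δ} (hZ : Z ∈ Subring.center (OrePolynomial θ δ))
    {c : Fin m → K} (hc : ∀ i, ¬ IsRamified θ δ (c i))
    (hdist : ∀ i j, i ≠ j → Z.remainder (c i) ≠ Z.remainder (c j))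
    {V : Fin m → Submodule (constantField θ δ) K} {k : ℕ}
    (hk : k ≤ ∑ i, Module.finrank (constantField θ δ) (V i))
    {P : OrePolynomial θ δ} (hP : P ∈ degreeLT θ δ k) (h : evalTuple c V P = 0) : P = 0 := by
  by_contra hP0
  obtain _ | d := k
  · exact hP0 (eq_zero_of_mem_degreeLT_zero hP)
  · have h1 := length_le_sumRankWeight_add hZ hc hdist V d hP0 hP
    rw [h, sumRankWeight_zero] at h1
    omega

theorem finrank_LRS [FiniteDimensional (constantField θ δ) K]
    {Z : OrePolynomial θ δ} (hZ : Z ∈ Subring.center (OrePolynomial θ δ))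
    {c : Fin m → K} (hc : ∀ i, ¬ IsRamified θ δ (c i))
    (hdist : ∀ i j, i ≠ j → Z.remainder (c i) ≠ Z.remainder (c j))
    {V : Fin m → Submodule (constantField θ δ) K} {k : ℕ}
    (hk : k ≤ ∑ i, Module.finrank (constantField θ δ) (V i)) :
    Module.finrank K (LRS k c V) = k := by
  have hinj : Function.Injective ((evalTuple c V).domRestrict (degreeLT θ δ k)) := by
    rw [injective_iff_map_eq_zero]
    rintro ⟨P, hP⟩ h
    exact Subtype.ext (eq_zero_of_evalTuple_eq_zero hZ hc hdist hk hP h)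
  rw [LRS, ← LinearMap.range_domRestrict, LinearMap.finrank_range_of_inj hinj, finrank_degreeLT]

theorem card_eq_sum_card_filter {α : Type*} [Fintype α] {β : α → Type*} [∀ i, Fintype (β i)]
    (S : Finset (Σ i, β i)) [∀ i, DecidablePred fun j : β i => (⟨i, j⟩ : Σ i, β i) ∈ S] :
    S.card = ∑ i, (Finset.univ.filter fun j : β i => (⟨i, j⟩ : Σ i, β i) ∈ S).card := by
  rw [← Finset.card_sigma]
  congr 1
  ext ⟨i, j⟩
  rw [Finset.mem_sigma, Finset.mem_filter]
  simp only [Finset.mem_univ, true_and]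

/-- Less than `k` linear conditions of the form `ev(P)(x) = 0` are satisfied by a nonzero
polynomial of degree `< k`. -/
theorem exists_evalTuple_apply_eq_zero (c : Fin m → K)
    (V : Fin m → Submodule (constantField θ δ) K) {k : ℕ} {ι : Type*} (S : Finset ι)
    (hS : S.card < k) (a : ι → Fin m) (e : ∀ s, V (a s)) :
    ∃ P ∈ degreeLT θ δ k, P ≠ 0 ∧ ∀ s ∈ S, evalTuple c V P (a s) (e s) = 0 := by
  -- Evaluation at a fixed vector is `K`-linear in `P`, since `K` acts through the codomain; each
  -- vector thus costs one equation over `K`.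
  let f : degreeLT θ δ k →ₗ[K] (S → K) :=
    { toFun := fun P s => evalTuple c V P (a s) (e s)
      map_add' := fun P Q => by
        ext s
        rw [Submodule.coe_add, map_add]
        rfl
      map_smul' := fun b P => by
        ext s
        rw [Submodule.coe_smul, map_smul]
        rfl }
  have hker : LinearMap.ker f ≠ ⊥ := by
    apply LinearMap.ker_ne_bot_of_finrank_lt
    rwa [finrank_degreeLT, Module.finrank_fintype_fun_eq_card, Fintype.card_coe]
  obtain ⟨⟨P, hP⟩, hPf, hP0⟩ := (Submodule.ne_bot_iff _).1 hker
  exact ⟨P, hP, fun h => hP0 (Subtype.ext h), fun s hs =>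
    congrFun (LinearMap.mem_ker.1 hPf) ⟨s, hs⟩⟩

theorem card_le_finrank_ker {F E E' ι : Type*} [Field F] [AddCommGroup E] [Module F E]
    [AddCommGroup E'] [Module F E'] [FiniteDimensional F E] {e : ι → E}
    (he : LinearIndependent F e) (f : E →ₗ[F] E') (T : Finset ι) (hT : ∀ j ∈ T, f (e j) = 0) :
    T.card ≤ Module.finrank F (LinearMap.ker f) := by
  have hli : LinearIndependent F fun j : T => (⟨e j, hT j j.2⟩ : LinearMap.ker f) := by
    apply LinearIndependent.of_comp (LinearMap.ker f).subtype
    exact he.comp _ Subtype.val_injective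
  rw [← Fintype.card_coe]
  exact hli.fintype_card_le_finrank

theorem exists_finset_sigma_card_eq {D : Fin m → ℕ} {r : ℕ} (h : r ≤ ∑ i, D i) :
    ∃ S : Finset (Σ i, Fin (D i)), S.card = r := by
  obtain ⟨S, -, hS⟩ := Finset.exists_subset_card_eq
    (s := (Finset.univ : Finset (Σ i, Fin (D i)))) (n := r) (by
      rw [Finset.card_univ, Fintype.card_sigma]
      simpa only [Fintype.card_fin] using h)
  exact ⟨S, hS⟩

/-- There is a nonzero polynomial of degree `< k` whose evaluations vanish on subspaces of total
dimension `k - 1`. -/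
theorem exists_evalTuple_vanishing [FiniteDimensional (constantField θ δ) K] (c : Fin m → K)
    (V : Fin m → Submodule (constantField θ δ) K) {k : ℕ} (hk1 : 1 ≤ k)
    (hk : k ≤ ∑ i, Module.finrank (constantField θ δ) (V i)) :
    ∃ P ∈ degreeLT θ δ k, P ≠ 0 ∧
      k - 1 ≤ ∑ i, Module.finrank (constantField θ δ) (LinearMap.ker (evalTuple c V P i)) := by
  -- `S` selects `k - 1` vectors from the union of fixed bases of the `V i`; they are independent
  -- inside each `V i`.
  obtain ⟨S, hS⟩ := exists_finset_sigma_card_eq ((Nat.sub_le k 1).trans hk)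
  obtain ⟨P, hP, hP0, hvan⟩ := exists_evalTuple_apply_eq_zero c V (k := k) S
    (hS.trans_lt (Nat.sub_lt hk1 one_pos)) Sigma.fst
    fun s => Module.finBasis (constantField θ δ) (V s.1) s.2
  refine ⟨P, hP, hP0, ?_⟩
  classical
  rw [← hS, card_eq_sum_card_filter]
  refine Finset.sum_le_sum fun i _ => ?_
  refine card_le_finrank_ker (Module.finBasis (constantField θ δ) (V i)).linearIndependent _ _ ?_
  intro j hj
  exact hvan ⟨i, j⟩ (Finset.mem_filter.1 hj).2

theorem hasMinDist_LRS [FiniteDimensional (constantField θ δ) K]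
    {Z : OrePolynomial θ δ} (hZ : Z ∈ Subring.center (OrePolynomial θ δ))
    {c : Fin m → K} (hc : ∀ i, ¬ IsRamified θ δ (c i))
    (hdist : ∀ i j, i ≠ j → Z.remainder (c i) ≠ Z.remainder (c j))
    {V : Fin m → Submodule (constantField θ δ) K} {k : ℕ} (hk1 : 1 ≤ k)
    (hk : k ≤ ∑ i, Module.finrank (constantField θ δ) (V i)) :
    HasMinDist (LRS k c V) (∑ i, Module.finrank (constantField θ δ) (V i) - k + 1) := by
  obtain ⟨d, rfl⟩ : ∃ d, k = d + 1 := ⟨k - 1, by omega⟩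
  constructor
  · obtain ⟨P, hP, hP0, hker⟩ := exists_evalTuple_vanishing c V hk1 hk
    refine ⟨evalTuple c V P, ⟨P, hP, rfl⟩, fun h => hP0 ?_, ?_⟩
    · exact eq_zero_of_evalTuple_eq_zero hZ hc hdist hk hP h
    · have h1 := length_le_sumRankWeight_add hZ hc hdist V d hP0 hP
      have h2 := sumRankWeight_add_sum_finrank_ker (evalTuple c V P)
      -- The kernels have total dimension at least `d`, so the weight is at most `n - d`; the
      -- general lower bound makes this an equality.
      omega
  · rintro _ ⟨_, ⟨P, hP, rfl⟩, hne, rfl⟩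
    have hP0 : P ≠ 0 := by
      rintro rfl
      exact hne (map_zero _)
    have h1 := length_le_sumRankWeight_add hZ hc hdist V d hP0 hP
    omega

end Code

/-! ### A normalized generator of the centre -/

section Centre

open OrePolynomial

variable {K : Type*} [Field K] {θ : K →+* K} {δ : TwistedDerivation θ}

theorem TwistedDerivation.exists_eq_inner (hθ : θ ≠ RingHom.id K) (δ : TwistedDerivation θ) :
    ∃ t : K, ∀ x, δ x = t * (θ x - x) := by
  obtain ⟨a, ha⟩ : ∃ a, θ a ≠ a := by
    by_contra! h
    exact hθ (RingHom.ext h)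
  have ha' : θ a - a ≠ 0 := sub_ne_zero.2 ha
  refine ⟨δ a / (θ a - a), fun x => ?_⟩
  rw [div_mul_eq_mul_div, eq_div_iff ha', δ.symmetry]

namespace OrePolynomial

theorem X_mem_degreeLT : X θ δ ∈ degreeLT θ δ (1 + 1) := by
  simpa [C_zero] using X_sub_C_mem (θ := θ) (δ := δ) 0

theorem coeff_X_one : (X θ δ).coeff 1 = 1 := by
  simpa [C_zero] using coeff_X_sub_C (θ := θ) (δ := δ) 0

/-- The top coefficient of a central polynomial of degree `n` is fixed by `θ`, and `θ ^ n` is the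
identity. -/
theorem top_of_mem_center {P : OrePolynomial θ δ}
    (hP : P ∈ Subring.center (OrePolynomial θ δ)) {n : ℕ} (hn : P ∈ degreeLT θ δ (n + 1))
    (h0 : P.coeff n ≠ 0) : θ ^ n = 1 ∧ θ (P.coeff n) = P.coeff n := by
  rw [Subring.mem_center_iff] at hP
  constructor
  · ext a
    have h := congrArg (fun Q => Q.coeff n) (hP (C θ δ a))
    have h1 := (mul_top (C_mem_degreeLT (θ := θ) (δ := δ) a) hn).2
    have h2 := (mul_top hn (C_mem_degreeLT (θ := θ) (δ := δ) a)).2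
    rw [zero_add] at h1
    simp only [add_zero] at h2
    simp only [h1, h2, coeff_C, if_true, pow_zero] at h
    exact mul_left_cancel₀ h0 (h.symm.trans (mul_comm _ _))
  · have h := congrArg (fun Q => Q.coeff (n + 1)) (hP (X θ δ))
    have h1 := (mul_top (X_mem_degreeLT (θ := θ) (δ := δ)) hn).2
    have h2 := (mul_top hn (X_mem_degreeLT (θ := θ) (δ := δ))).2
    rw [add_comm 1 n] at h1
    simpa only [h1, h2, coeff_X_one, one_mul, mul_one, map_one, pow_one] using h

/-- The change of variable `L = X + t` absorbs the inner derivation: `L a = θ(a) L`. -/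
theorem X_sub_C_pow_mul_C {t : K} (ht : ∀ x, δ x = t * (θ x - x)) (i : ℕ) (a : K) :
    (X θ δ - C θ δ (-t)) ^ i * C θ δ a = C θ δ ((θ ^ i) a) * (X θ δ - C θ δ (-t)) ^ i := by
  induction i generalizing a with
  | zero => rw [pow_zero, one_mul, mul_one]; rfl
  | succ i ih =>
    have h1 : (X θ δ - C θ δ (-t)) * C θ δ a = C θ δ (θ a) * (X θ δ - C θ δ (-t)) := by
      rw [sub_mul, X_mul_C, mul_sub, add_sub_assoc, sub_eq_add_neg (C θ δ (θ a) * X θ δ), C_mul_C,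
        C_mul_C, ← C_sub, ht]
      congr 1
      rw [eq_neg_iff_add_eq_zero, ← C_add, ← C_zero]
      congr 1
      ring
    rw [pow_succ, mul_assoc, h1, ← mul_assoc, ih, mul_assoc, ← pow_succ, pow_succ θ]
    rfl

theorem exists_normalized_of_ne_id (hθ : θ ≠ RingHom.id K) :
    ∃ Z : OrePolynomial θ δ, Z.IsCentreGenerator ∧ Z.IsNormalized := by
  obtain ⟨t, ht⟩ := δ.exists_eq_inner hθ
  set L := X θ δ - C θ δ (-t) with hL
  -- If `θ` has infinite order then `r = 0`, `L ^ r = 1`, and the argument below still applies,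
  -- giving centre `F`.
  set r := orderOf θ with hr
  have htop := pow_top (X_sub_C_mem (θ := θ) (δ := δ) (-t)) (coeff_X_sub_C _) r
  rw [mul_one, ← hL] at htop
  have hdeg : (L ^ r).natDegree = r := natDegree_eq htop.1 (by rw [htop.2]; exact one_ne_zero)
  have hcomm : ∀ a, C θ δ a * L ^ r = L ^ r * C θ δ a := by
    intro a
    rw [hL, X_sub_C_pow_mul_C ht, hr, pow_orderOf_eq_one]
    rfl
  have hZ : L ^ r ∈ Subring.center (OrePolynomial θ δ) := by
    refine mem_center_of_commute hcomm ?_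
    have hX : X θ δ = L + C θ δ (-t) := by rw [hL, sub_add_cancel]
    rw [hX, add_mul, mul_add, hcomm, ← pow_succ, ← pow_succ']
  refine ⟨L ^ r, ⟨?_, ?_⟩, ⟨fun h => absurd h hθ, fun _ => ⟨L, r, natDegree_X_sub_C _, rfl⟩⟩⟩
  · rw [Monic, hdeg, htop.2]
  · refine center_eq_closure_of_reduction hZ fun n P hP hn ih => ?_
    by_cases h0 : P.coeff n = 0
    · exact ih P hP (mem_degreeLT_of_coeff_eq_zero hn h0)
    · obtain ⟨h1, h2⟩ := top_of_mem_center hP hn h0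
      obtain ⟨q, rfl⟩ := orderOf_dvd_of_pow_eq_one h1
      -- `θ` fixes the top coefficient, and then `δ = t (θ - id)` kills it, so it lies in `F`.
      have hb : P.coeff (r * q) ∈ constantField θ δ := ⟨h2, by
        rw [ht, h2, sub_self, mul_zero]⟩
      have hq := pow_top htop.1 htop.2 q
      have hC := C_mem_degreeLT (θ := θ) (δ := δ) (P.coeff (r * q))
      have hm := mul_top hC hq.1
      rw [zero_add, mul_comm q r] at hm
      have hZmem : L ^ r ∈ Subring.closure (C θ δ '' (constantField θ δ : Set K) ∪ {L ^ r}) :=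
        Subring.subset_closure (Or.inr rfl)
      have hmem : C θ δ (P.coeff (r * q)) * (L ^ r) ^ q ∈
          Subring.closure (C θ δ '' (constantField θ δ : Set K) ∪ {L ^ r}) :=
        mul_mem (Subring.subset_closure (Or.inl ⟨_, hb, rfl⟩))
          (pow_mem hZmem q)
      have hsub := ih (P - C θ δ (P.coeff (r * q)) * (L ^ r) ^ q)
        (sub_mem hP (mul_mem (C_mem_center hb) (pow_mem hZ q)))
        (mem_degreeLT_of_coeff_eq_zero (Submodule.sub_mem _ hn hm.1) (by
          rw [coeff_sub, hm.2, mul_comm r q, hq.2, coeff_C]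
          simp))
      rw [← sub_add_cancel P (C θ δ (P.coeff (r * q)) * (L ^ r) ^ q)]
      exact Subring.add_mem _ hsub hmem

/-- A monic polynomial of minimal degree in the kernel of an evaluation map. -/
theorem exists_minimal_ker_evalMap [FiniteDimensional (constantField θ δ) K] (c : K) :
    ∃ (d : ℕ) (Z : OrePolynomial θ δ), Z ∈ degreeLT θ δ (d + 1) ∧ Z.coeff d = 1 ∧
      evalMap θ δ c Z = 0 ∧ ∀ P ∈ degreeLT θ δ d, evalMap θ δ c P = 0 → P = 0 := by
  have hex : ∃ d, ∃ P ∈ degreeLT θ δ (d + 1), P ≠ 0 ∧ evalMap θ δ c P = 0 := by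
    -- `[K : F] < ∞` makes `End_F(K)` finite-dimensional over `K`, so the powers of `δ + c θ` are
    -- `K`-linearly dependent.
    have : FiniteDimensional K (Module.End (constantField θ δ) K) :=
      Module.Finite.of_restrictScalars_finite (constantField θ δ) K _
    have hker : LinearMap.ker ((evalMap θ δ c).domRestrict (degreeLT θ δ
        (Module.finrank K (Module.End (constantField θ δ) K) + 1))) ≠ ⊥ := by
      apply LinearMap.ker_ne_bot_of_finrank_lt
      rw [finrank_degreeLT]
      exact Nat.lt_succ_self _
    obtain ⟨⟨P, hP⟩, h, hP0⟩ := (Submodule.ne_bot_iff _).1 hker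
    exact ⟨_, P, hP, fun h => hP0 (Subtype.ext h), h⟩
  classical
  obtain ⟨P, hP, hP0, hPc⟩ := Nat.find_spec hex
  have hmin : ∀ Q ∈ degreeLT θ δ (Nat.find hex), evalMap θ δ c Q = 0 → Q = 0 := by
    intro Q hQ hQc
    by_contra hQ0
    obtain hd | ⟨d, hd⟩ := (Nat.eq_zero_or_pos (Nat.find hex)).imp_right Nat.exists_eq_add_one.2
    · rw [hd] at hQ
      exact hQ0 (eq_zero_of_mem_degreeLT_zero hQ)
    · exact Nat.find_min hex (m := d) (by omega) ⟨Q, by rwa [hd] at hQ, hQ0, hQc⟩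
  have htop : P.coeff (Nat.find hex) ≠ 0 := fun h =>
    hP0 (hmin P (mem_degreeLT_of_coeff_eq_zero hP h) hPc)
  refine ⟨Nat.find hex, (P.coeff (Nat.find hex))⁻¹ • P, Submodule.smul_mem _ _ hP, ?_, ?_, hmin⟩
  · rw [coeff_smul, inv_mul_cancel₀ htop]
  · rw [map_smul, hPc, smul_zero]

/-- At `c = 0` the variable acts as `δ`, which kills `1`. For central `P` the scalar by which it
acts is thus its constant term. -/
theorem evalMap_zero_one (P : OrePolynomial θ δ) : evalMap θ δ 0 P 1 = P.coeff 0 := by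
  induction P using induction_on with
  | h0 => simp
  | hadd P Q hP hQ => rw [map_add, LinearMap.add_apply, hP, hQ, coeff_add]
  | hmon i a =>
    rw [evalMap_monomial, coeff_monomial]
    change a * (pseudoLinear θ δ 0 ^ i) 1 = _
    obtain _ | i := i
    · simp
    · rw [pow_succ, Module.End.mul_apply, pseudoLinear_one]
      simp

theorem coeff_mul_X_succ (P : OrePolynomial θ δ) (k : ℕ) :
    (P * X θ δ).coeff (k + 1) = P.coeff k := by
  induction P using induction_on with
  | h0 => simp
  | hadd P Q hP hQ => rw [add_mul, coeff_add, hP, hQ, coeff_add]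
  | hmon i a =>
    have h : X θ δ = mulXLeft θ δ (C θ δ 1) := by rw [← X_mul, C_one, mul_one]
    have h1 : monomial θ δ i a * X θ δ = monomial θ δ (i + 1) a := by
      rw [monomial_mul, monomial_eq_smul_pow (i + 1), h, pow_succ]
      rfl
    rw [h1, coeff_monomial, coeff_monomial]
    simp

theorem coeff_mul_X_zero (P : OrePolynomial θ δ) : (P * X θ δ).coeff 0 = 0 := by
  rw [← evalMap_zero_one, evalMap_mul, Module.End.mul_apply, evalMap_X, pseudoLinear_one, map_zero]

/-- When `θ = id`, the commutator with `X` is `δ` on the coefficients. -/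
theorem coeff_X_mul_sub_mul_X {δ : TwistedDerivation (RingHom.id K)}
    (P : OrePolynomial (RingHom.id K) δ) (k : ℕ) :
    (X _ δ * P - P * X _ δ).coeff k = δ (P.coeff k) := by
  rw [coeff_sub, X_mul]
  obtain _ | k := k
  · rw [coeff_mulXLeft_zero, coeff_mul_X_zero, sub_zero]
  · rw [coeff_mulXLeft_succ, coeff_mul_X_succ, RingHom.id_apply, add_sub_cancel_left]

/-- When `θ = id`, the monic polynomial of minimal degree in the kernel of the evaluation at `0`
is central. -/
theorem mem_center_of_minimal {δ : TwistedDerivation (RingHom.id K)} {d : ℕ}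
    {Z : OrePolynomial (RingHom.id K) δ} (hd : Z ∈ degreeLT _ δ (d + 1)) (h1 : Z.coeff d = 1)
    (hZ0 : evalMap _ δ 0 Z = 0)
    (hmin : ∀ P ∈ degreeLT (RingHom.id K) δ d, evalMap _ δ 0 P = 0 → P = 0) :
    Z ∈ Subring.center (OrePolynomial (RingHom.id K) δ) := by
  refine mem_center_of_commute (fun a => ?_) ?_
  · rw [← sub_eq_zero]
    -- The commutator with `a` is killed by evaluation at `0`. Its terms of degree `d` cancel
    -- because `θ = id`, so minimality makes it zero.
    refine hmin _ ?_ (by rw [map_sub, evalMap_mul, evalMap_mul, hZ0, mul_zero, zero_mul, sub_zero])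
    have hl := mul_top (C_mem_degreeLT (δ := δ) a) hd
    have hr := mul_top hd (C_mem_degreeLT (δ := δ) a)
    rw [zero_add] at hl
    refine mem_degreeLT_of_coeff_eq_zero (Submodule.sub_mem _ hl.1 hr.1) ?_
    have hid : (RingHom.id K ^ d) a = a := by
      rw [← RingHom.one_def, one_pow, RingHom.one_def, RingHom.id_apply]
    have hr2 : (Z * C _ δ a).coeff d = a := by
      rw [← add_zero d, hr.2, coeff_C, if_pos rfl, h1, hid, one_mul]
    rw [coeff_sub, hl.2, hr2, coeff_C, if_pos rfl, pow_zero, h1, map_one, mul_one, sub_self]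
  · rw [← sub_eq_zero]
    refine hmin _ (fun k hk => ?_)
      (by rw [map_sub, evalMap_mul, evalMap_mul, hZ0, mul_zero, zero_mul, sub_zero])
    rw [coeff_X_mul_sub_mul_X]
    -- The commutator with `X` applies `δ` to the coefficients, and the top one is `1`.
    rcases hk.eq_or_lt with rfl | hk
    · rw [h1, δ.map_one]
    · rw [hd k hk, map_zero]

theorem center_eq_closure_of_minimal {δ : TwistedDerivation (RingHom.id K)} {d : ℕ} (hd0 : 1 ≤ d)
    {Z : OrePolynomial (RingHom.id K) δ} (hd : Z ∈ degreeLT _ δ (d + 1)) (h1 : Z.coeff d = 1)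
    (hZ0 : evalMap _ δ 0 Z = 0)
    (hmin : ∀ P ∈ degreeLT (RingHom.id K) δ d, evalMap _ δ 0 P = 0 → P = 0) :
    Subring.center (OrePolynomial (RingHom.id K) δ) =
      Subring.closure (C _ δ '' (constantField _ δ : Set K) ∪ {Z}) := by
  have hZ := mem_center_of_minimal hd h1 hZ0 hmin
  have hZne : Z ≠ 0 := by
    rintro rfl
    exact zero_ne_one h1
  have hZdeg : Z.natDegree = d := natDegree_eq hd (by rw [h1]; exact one_ne_zero)
  refine center_eq_closure_of_reduction hZ fun n P hP hn ih => ?_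
  set p := P.coeff 0 with hp
  have hpF : p ∈ constantField _ δ := by
    refine ⟨rfl, ?_⟩
    rw [hp, ← coeff_X_mul_sub_mul_X, Subring.mem_center_iff.1 hP, sub_self, coeff_zero]
  obtain ⟨Q, R, hQR, hR⟩ := exists_eq_mul_add hd h1 (P - C _ δ p)
  have hPp : evalMap _ δ 0 (P - C _ δ p) = 0 := by
    ext x
    rw [map_sub, LinearMap.sub_apply, evalMap_of_mem_center hP, evalMap_zero_one, evalMap_C,
      sub_self, LinearMap.zero_apply]
  have hR0 : R = 0 := by
    refine hmin R hR ?_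
    rwa [hQR, map_add, evalMap_mul, hZ0, mul_zero, zero_add] at hPp
  rw [hR0, add_zero] at hQR
  -- `Q Z = P - p` and `Z` are central and `Z ≠ 0` cancels, so `Q` is central too.
  have hQ : Q ∈ Subring.center (OrePolynomial (RingHom.id K) δ) := by
    rw [Subring.mem_center_iff]
    intro A
    have h := Subring.mem_center_iff.1 (Subring.sub_mem _ hP (C_mem_center hpF)) A
    rw [hQR, ← mul_assoc, mul_assoc Q, ← Subring.mem_center_iff.1 hZ A, ← mul_assoc] at h
    exact mul_right_cancel₀ hZne h
  have hQc : Q ∈ Subring.closure (C _ δ '' (constantField _ δ : Set K) ∪ {Z}) := by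
    by_cases hQ0 : Q = 0
    · rw [hQ0]
      exact Subring.zero_mem _
    · refine ih Q hQ (degreeLT_mono ?_ Q.mem_degreeLT_natDegree_succ)
      have := natDegree_add_le_of_mul_mem hQ0 hZne
        (hQR ▸ Submodule.sub_mem _ hn (C_mem_degreeLT_of_pos (by omega) p))
      omega
  rw [← sub_add_cancel P (C _ δ p), hQR]
  exact Subring.add_mem _ (Subring.mul_mem _ hQc (Subring.subset_closure (Or.inr rfl)))
    (Subring.subset_closure (Or.inl ⟨p, hpF, rfl⟩))

theorem pseudoLinear_zero (x : K) : pseudoLinear θ δ 0 x = δ x := by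
  rw [pseudoLinear_apply, zero_mul, add_zero]

/-- Leibniz's formula for `Xⁱ b` when `θ = id`. -/
theorem coeff_mulXLeft_pow_C {δ : TwistedDerivation (RingHom.id K)} (i l : ℕ) (b : K) :
    ((mulXLeft _ δ ^ i) (C _ δ b)).coeff l =
      i.choose l • (pseudoLinear _ δ 0 ^ (i - l)) b := by
  induction i generalizing l with
  | zero =>
    rw [pow_zero]
    change (C _ δ b).coeff l = _
    rw [coeff_C]
    obtain _ | l := l <;> simp
  | succ i ih =>
    rw [pow_succ']
    change (mulXLeft _ δ ((mulXLeft _ δ ^ i) (C _ δ b))).coeff l = _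
    obtain _ | l := l
    · rw [coeff_mulXLeft_zero, ih, ← pseudoLinear_zero]
      simp [pow_succ']
    · rw [coeff_mulXLeft_succ, ih, ih, RingHom.id_apply, Nat.choose_succ_succ, add_smul,
        Nat.add_sub_add_right, add_right_inj, map_nsmul]
      rcases lt_or_ge l i with hl | hl
      · rw [← pseudoLinear_zero, show i - l = i - (l + 1) + 1 by omega, pow_succ']
        rfl
      · rw [Nat.choose_eq_zero_of_lt (by omega), zero_smul, zero_smul]

/-- The coefficients of the minimal polynomial are killed by the inner binomial coefficients. -/
theorem coeff_mul_choose_eq_zero {δ : TwistedDerivation (RingHom.id K)} {d : ℕ} (hd0 : 1 ≤ d)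
    {Z : OrePolynomial (RingHom.id K) δ} (hd : Z ∈ degreeLT _ δ (d + 1)) (h1 : Z.coeff d = 1)
    (hZ0 : evalMap _ δ 0 Z = 0)
    (hmin : ∀ P ∈ degreeLT (RingHom.id K) δ d, evalMap _ δ 0 P = 0 → P = 0)
    {l j : ℕ} (hl : 1 ≤ l) (hj : 1 ≤ j) : Z.coeff (l + j) * ((l + j).choose l : K) = 0 := by
  have hZ := Subring.mem_center_iff.1 (mem_center_of_minimal hd h1 hZ0 hmin)
  -- The coefficient of `X ^ l` in `Z b = b Z` reads `∑ z_i (i choose l) δ^(i-l)(b) = z_l b` for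
  -- every `b`, that is `R(δ) = 0`. For `i < l` the subtraction is truncated, but the binomial
  -- coefficient is zero. The degree of `R` is below `d` because `l ≥ 1`.
  set R : OrePolynomial (RingHom.id K) δ :=
    ∑ i ∈ Finset.range (d + 1), monomial _ δ (i - l) (Z.coeff i * (i.choose l : K)) -
      C _ δ (Z.coeff l) with hR
  have hRd : R ∈ degreeLT _ δ d := by
    refine Submodule.sub_mem _ (Submodule.sum_mem _ fun i hi k hk => ?_)
      (C_mem_degreeLT_of_pos hd0 _)
    have := Finset.mem_range.1 hi
    rw [coeff_monomial, if_neg (by omega)]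
  have hR0 : evalMap _ δ 0 R = 0 := by
    ext b
    have h := congrArg (fun P => P.coeff l) (hZ (C _ δ b))
    simp only [mul_eq_sum hd, coeff_sum, coeff_smul, coeff_mulXLeft_pow_C, C_mul] at h
    rw [hR, map_sub, LinearMap.sub_apply, evalMap_C, map_sum, LinearMap.sum_apply,
      LinearMap.zero_apply, sub_eq_zero, mul_comm, h]
    refine Finset.sum_congr rfl fun i _ => ?_
    rw [evalMap_monomial, nsmul_eq_mul, ← mul_assoc]
    rfl
  by_cases hlj : l + j ≤ d
  · have h := congrArg (fun P => P.coeff j) (hmin R hRd hR0)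
    simp only [hR, coeff_sub, coeff_sum, coeff_monomial, coeff_C, coeff_zero] at h
    rw [if_neg (by omega), sub_zero, Finset.sum_eq_single (l + j), if_pos (by omega)] at h
    · exact h
    · intro i _ hi
      rw [if_neg (by omega)]
    · intro hn
      exact absurd (Finset.mem_range.2 (by omega)) hn
  · rw [hd _ (by omega), zero_mul]

theorem exists_normalized_of_id {δ : TwistedDerivation (RingHom.id K)}
    [FiniteDimensional (constantField (RingHom.id K) δ) K] (hδ : ¬ ∀ x, δ x = 0) :
    ∃ Z : OrePolynomial (RingHom.id K) δ, Z.IsCentreGenerator ∧ Z.IsNormalized := by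
  obtain ⟨d, Z, hd, h1, hZ0, hmin⟩ := exists_minimal_ker_evalMap (δ := δ) 0
  have hcoeff : Z.coeff 0 = 0 := by rw [← evalMap_zero_one, hZ0, LinearMap.zero_apply]
  -- Degree 0 is excluded by the zero constant term; degree 1 would give `Z = X`, hence `δ = 0`.
  have hd2 : 2 ≤ d := by
    by_contra! hlt
    obtain rfl | rfl : d = 0 ∨ d = 1 := by omega
    · exact zero_ne_one (hcoeff.symm.trans h1)
    · refine hδ fun x => ?_
      have hZX : Z = X _ δ := by
        rw [eq_sum_monomial hd]
        simp only [Finset.sum_range_succ, Finset.sum_range_zero, hcoeff, h1, map_zero, zero_add]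
        rfl
      rw [← pseudoLinear_zero, ← evalMap_X, ← hZX, hZ0, LinearMap.zero_apply]
  have hchoose : ∀ {l j : ℕ}, 1 ≤ l → 1 ≤ j → Z.coeff (l + j) * ((l + j).choose l : K) = 0 :=
    fun hl hj => coeff_mul_choose_eq_zero (by omega) hd h1 hZ0 hmin hl hj
  have hdeg : Z.natDegree = d := natDegree_eq hd (by rw [h1]; exact one_ne_zero)
  refine ⟨Z, ⟨by rw [Monic, hdeg, h1], center_eq_closure_of_minimal (by omega) hd h1 hZ0 hmin⟩,
    ⟨fun _ => ?_, fun h => absurd rfl h⟩⟩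
  obtain ⟨p, hp⟩ := CharP.exists K
  have hpp : p.Prime := by
    refine (CharP.char_is_prime_or_zero K p).resolve_right ?_
    rintro rfl
    -- With `l = 1` and top coefficient `1`, the relation says `d = 0` in `K`, impossible in
    -- characteristic 0.
    have h := hchoose (l := 1) (j := d - 1) le_rfl (by omega)
    rw [show 1 + (d - 1) = d by omega, h1, one_mul, Nat.choose_one_right,
      CharP.cast_eq_zero_iff K 0, zero_dvd_iff] at h
    omega
  refine ⟨p, hpp, hp, fun i hi => ⟨multiplicity p i, ?_⟩⟩
  have : Fact p.Prime := ⟨hpp⟩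
  have hi0 : i ≠ 0 := by
    rintro rfl
    exact hi hcoeff
  -- An `i > 0` all of whose inner binomial coefficients are divisible by `p` is a power of `p`.
  refine Choose.eq_pow_multiplicity_of_choose_modEq_zero_nat (Nat.pos_of_ne_zero hi0) ?_
  intro l hl
  rw [Finset.mem_Icc] at hl
  have h := hchoose (l := l) (j := i - l) hl.1 (by omega)
  rw [show l + (i - l) = i by omega] at h
  exact (Nat.modEq_zero_iff_dvd).2
    ((CharP.cast_eq_zero_iff K p _).1 ((mul_eq_zero.1 h).resolve_left hi))

end OrePolynomial

end Centre

theorem mainTheorem4 {K : Type*} [Field K] (θ : K →+* K) (δ : TwistedDerivation θ)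
    (hfin : FiniteDimensional (constantField θ δ) K)
    (hne : ¬ (θ = RingHom.id K ∧ ∀ x : K, δ x = 0)) :
    (∃ Z : OrePolynomial θ δ, Z.IsCentreGenerator ∧ Z.IsNormalized) ∧
    ∀ Z : OrePolynomial θ δ, Z.IsCentreGenerator →
      ∀ (m k n : ℕ) (c : Fin m → K) (V : Fin m → Submodule (constantField θ δ) K),
        (∀ i, ¬ IsRamified θ δ (c i)) →
        (∀ i j, i ≠ j → Z.remainder (c i) ≠ Z.remainder (c j)) →
        n = ∑ i, Module.finrank (constantField θ δ) (V i) →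
        k ≤ n →
        codeLength (LRS k c V) = n ∧
        Module.finrank K (LRS k c V) = k ∧
        (1 ≤ k → HasMinDist (LRS k c V) (n - k + 1) ∧ IsMSRD (LRS k c V)) := by
  refine ⟨?_, ?_⟩
  · by_cases hθ : θ = RingHom.id K
    · subst hθ
      exact OrePolynomial.exists_normalized_of_id fun h => hne ⟨rfl, h⟩
    · exact OrePolynomial.exists_normalized_of_ne_id hθ
  · rintro Z hZ m k n c V hc hdist rfl hk
    have hZc : Z ∈ Subring.center (OrePolynomial θ δ) := by
      rw [hZ.centre_eq]
      exact Subring.subset_closure (Or.inr rfl)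
    have hdim := finrank_LRS hZc hc hdist hk
    refine ⟨rfl, hdim, fun hk1 => ?_⟩
    have hmin := hasMinDist_LRS hZc hc hdist hk1 hk
    refine ⟨hmin, _, hmin, ?_⟩
    rw [hdim, codeLength]
    omega
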